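/- Let $E$ be a (real or complex) Banach space that contains no isomorphic copy of $c_0$, let $m\ge 1$, let $T_1,\dots,T_m$ be commuting power-bounded linear operators on $E$ (i.e. $\sup_n\|T_j^n\|<\infty$ for each $j$), and let $\mathcal S$ be the operator semigroup generated by $T_1,\dots,T_m$. Put $$E_{\mathrm{aap}}=\{y\in E : \mathcal S y=\{Sy : S\in\mathcal S\}\text{ is relatively compact}\},$$ an $\mathcal S$-invariant subspace of $E$, and let $\overline{\mathcal S}$ be the closure of the restricted semigroup $\mathcal S|_{E_{\mathrm{aap}}}$ in $\mathscr L(E_{\mathrm{aap}})$ with respect to the strong operator topology. There is a unique projection $P\in\overline{\mathcal S}$ (the Jacobs–de Leeuw–Glicksberg projection) such that $\overline{\mathcal S}$ restricted to $\operatorname{rg}P$ is a compact topological group (for the strong operator topology) and $\overline{\mathcal S}$ restricted to $\ker P$ contains the zero operator. For this $P$ and every $x\in E$ the following assertions are equivalent: (a) $\mathcal S x$ is relatively compact. (b) $\mathcal S(I-T_j)x=\{S(x-T_jx) : S\in\mathcal S\}$ is relatively compact for every $j\in\{1,\dots,m\}$, and $(I-P)(I-\mathcal S)x=\{(I-P)(x-Sx)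 : S\in\mathcal S\}$ is relatively compact. (The first condition in (b) implies that $x-Sx\in E_{\mathrm{aap}}$ for all $S\in\mathcal S$, so that the second condition makes sense.) -/

import Mathlib

open scoped Pointwise ZeroAtInfty

namespace OrbitCompactness

section Basic

variable {𝕜 : Type*} [RCLike 𝕜] {E : Type*} [NormedAddCommGroup E] [NormedSpace 𝕜 E]

/-- A subset of a topological space is relatively compact if its closure is compact. -/
def RelCompact {X : Type*} [TopologicalSpace X] (A : Set X) : Prop :=
  IsCompact (closure A)

variable (𝕜 E) in
/-- `E` contains an isomorphic copy of the Banach space `c₀` of null sequences with the supremum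
norm: some linear subspace of `E` is linearly homeomorphic to `c₀`. -/
def ContainsCZero : Prop :=
  ∃ F : Submodule 𝕜 E, Nonempty (C₀(ℕ, 𝕜) ≃L[𝕜] F)

/-- `T` is power-bounded: `sup_n ‖T ^ n‖ < ∞`. -/
def IsPowerBounded (T : E →L[𝕜] E) : Prop :=
  ∃ C : ℝ, ∀ n : ℕ, ‖T ^ n‖ ≤ C

/-- The operator semigroup generated by `T₁, …, Tₘ` (with composition as multiplication). -/
def generatedSemigroup {m : ℕ} (T : Fin m → E →L[𝕜] E) : Subsemigroup (E →L[𝕜] E) :=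
  Subsemigroup.closure (Set.range T)

/-- The orbit `𝒮 x = {S x ∣ S ∈ 𝒮}`. -/
def orbit (S : Subsemigroup (E →L[𝕜] E)) (x : E) : Set E :=
  {y | ∃ R ∈ S, R x = y}

theorem relCompact_add {A B C : Set E} (hA : RelCompact A) (hB : RelCompact B)
    (h : C ⊆ A + B) : RelCompact C :=
  (IsCompact.add hA hB).closure_of_subset
    (h.trans (Set.add_subset_add subset_closure subset_closure))

/-- The subspace `E_aap = {x ∈ E ∣ 𝒮 x is relatively compact}`. -/
def aap (S : Subsemigroup (E →L[𝕜] E)) : Submodule 𝕜 E where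
  carrier := {x | RelCompact (orbit S x)}
  zero_mem' := (isCompact_singleton (x := (0 : E))).closure_of_subset (by
    rintro _ ⟨R, _, rfl⟩
    simp)
  add_mem' := by
    intro x y hx hy
    refine relCompact_add hx hy ?_
    rintro _ ⟨R, hR, rfl⟩
    exact ⟨R x, ⟨R, hR, rfl⟩, R y, ⟨R, hR, rfl⟩, (map_add R x y).symm⟩
  smul_mem' := by
    intro c x hx
    refine (IsCompact.smul c hx).closure_of_subset ?_
    rintro _ ⟨R, hR, rfl⟩
    exact ⟨R x, subset_closure ⟨R, hR, rfl⟩, (map_smul R c x).symm⟩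

theorem mem_aap {S : Subsemigroup (E →L[𝕜] E)} {x : E} :
    x ∈ aap S ↔ RelCompact (orbit S x) :=
  Iff.rfl

theorem apply_mem_aap {S : Subsemigroup (E →L[𝕜] E)} {R : E →L[𝕜] E} (hR : R ∈ S) {x : E}
    (hx : x ∈ aap S) : R x ∈ aap S := by
  refine IsCompact.closure_of_subset hx ?_
  rintro _ ⟨Q, hQ, rfl⟩
  exact subset_closure ⟨Q * R, S.mul_mem hQ hR, rfl⟩

/-- If the differences with respect to the generators belong to `E_aap`, then so do all
differences `(I - R) x` for `R` in the generated semigroup. -/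
theorem sub_apply_mem_aap {m : ℕ} {T : Fin m → E →L[𝕜] E} {x : E}
    (h : ∀ j, RelCompact (orbit (generatedSemigroup T) (x - T j x)))
    {R : E →L[𝕜] E} (hR : R ∈ generatedSemigroup T) :
    x - R x ∈ aap (generatedSemigroup T) := by
  induction hR using Subsemigroup.closure_induction with
  | mem R hR =>
    obtain ⟨j, rfl⟩ := hR
    exact h j
  | mul R Q hR hQ ihR ihQ =>
    have : x - (R * Q) x = (x - R x) + R (x - Q x) := by simp
    rw [this]
    exact add_mem ihR (apply_mem_aap hR ihQ)

/-- The restrictions to the subspace `F` of those operators in `𝒯` which leave `F` invariant. -/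
def restrictTo (𝒯 : Set (E →L[𝕜] E)) (F : Submodule 𝕜 E) : Set (F →L[𝕜] F) :=
  {A | ∃ R ∈ 𝒯, ∀ y : F, (A y : E) = R y}

/-- Every operator of `𝒮` leaves `E_aap` invariant, so it has a restriction in `𝒮|E_aap`. -/
theorem exists_restrictTo_aap {S : Subsemigroup (E →L[𝕜] E)} {R : E →L[𝕜] E} (hR : R ∈ S) :
    ∃ A ∈ restrictTo (S : Set (E →L[𝕜] E)) (aap S), ∀ y : aap S, (A y : E) = R y :=
  ⟨R.restrict (fun _ hy => apply_mem_aap hR hy), ⟨R, hR, fun _ => rfl⟩, fun _ => rfl⟩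

/-- The identity map from bounded operators with the norm topology to bounded operators with the
strong operator topology. -/
def toSOT : (E →L[𝕜] E) ≃ (E →Lₚₜ[𝕜] E) :=
  UniformConvergenceCLM.ofFun (RingHom.id 𝕜) E {s : Set E | Finite s}

/-- The closure of a set of operators in the strong operator topology. -/
def sotClosure (𝒯 : Set (E →L[𝕜] E)) : Set (E →L[𝕜] E) :=
  toSOT ⁻¹' closure (toSOT '' 𝒯)

/-- The set `G` of operators on `E` is, with composition and the strong operator topology, a
compact topological group whose neutral element is the identity operator. -/
structure IsCompactOperatorGroup (G : Set (E →L[𝕜] E)) : Prop where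
  one_mem : 1 ∈ G
  mul_mem : ∀ A ∈ G, ∀ B ∈ G, A * B ∈ G
  exists_inv : ∀ A ∈ G, ∃ B ∈ G, A * B = 1 ∧ B * A = 1
  isCompact : IsCompact (toSOT '' G)
  continuousOn_mul :
    ContinuousOn (fun p : (E →Lₚₜ[𝕜] E) × (E →Lₚₜ[𝕜] E) =>
      toSOT (toSOT.symm p.1 * toSOT.symm p.2)) ((toSOT '' G) ×ˢ (toSOT '' G))
  continuousOn_inv :
    ContinuousOn (fun A : E →Lₚₜ[𝕜] E => toSOT (Ring.inverse (toSOT.symm A))) (toSOT '' G)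

end Basic

section Projection

variable {𝕜 : Type*} [RCLike 𝕜] {E : Type*} [NormedAddCommGroup E] [NormedSpace 𝕜 E]

/-- For a set `𝒯` of operators on `E`, the operator `P` on `E` is a projection as in the
Jacobs–de Leeuw–Glicksberg decomposition of `𝒯`: it is a projection in the strong operator closure
of `𝒯`, this closure restricts to a compact topological group on the range of `P`, and its
restriction to the kernel of `P` contains the zero operator. -/
structure IsJdLGProjection (𝒯 : Set (E →L[𝕜] E)) (P : E →L[𝕜] E) : Prop where
  mem_sotClosure : P ∈ sotClosure 𝒯
  isIdempotentElem : IsIdempotentElem P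
  group_on_range :
    IsCompactOperatorGroup (restrictTo (sotClosure 𝒯) (LinearMap.range (P : E →ₗ[𝕜] E)))
  zero_on_ker :
    (0 : LinearMap.ker (P : E →ₗ[𝕜] E) →L[𝕜] LinearMap.ker (P : E →ₗ[𝕜] E)) ∈
      restrictTo (sotClosure 𝒯) (LinearMap.ker (P : E →ₗ[𝕜] E))

/-- `P` is the Jacobs–de Leeuw–Glicksberg projection on `E_aap` of the semigroup `𝒮`, i.e. the one
of the restricted semigroup `𝒮|E_aap`. -/
def IsAapProjection (S : Subsemigroup (E →L[𝕜] E)) (P : aap S →L[𝕜] aap S) : Prop :=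
  IsJdLGProjection (restrictTo (S : Set (E →L[𝕜] E)) (aap S)) P

/-- The set `(I - P)(I - 𝒮) x`, where `P` acts on `E_aap`: all vectors `y - P y` for the elements
`y` of `E_aap` of the form `y = x - R x` with `R ∈ 𝒮`. -/
def stableDifferences (S : Subsemigroup (E →L[𝕜] E)) (P : aap S →L[𝕜] aap S) (x : E) : Set E :=
  {z | ∃ R ∈ S, ∃ y : aap S, (y : E) = x - R x ∧ z = y - P y}

end Projection

end OrbitCompactness

/-! The nontrivial direction is (b) ⇒ (a). For `R` in the semigroup write R x = x - P(x - R x) - (I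
- P)(x - R x). The last term is relatively compact by hypothesis, so it remains to treat b(R) = P(x
- R x). This is a bounded cocycle, b(gh) = b(g) + g b(h), with values in the range of P. There the
semigroup acts by restrictions of elements of a bounded group, hence is uniformly bounded below, and
every b(w) has a relatively compact orbit.

Suppose b has an ε-separated sequence of values b(u_n). Commuting monomials in finitely many
generators satisfy Dickson's lemma, so after passing to a subsequence u_j = u_i q for i < j. Then
b(u_j) - b(u_i) = u_i b(q) forces b(q) away from zero. Compactness of finitely many orbits allows i
< j with u_j b(w) ≈ u_i b(w), and cancelling u_i gives q b(w) ≈ b(w) for finitely many prescribed w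
(`totallyBounded_range_cocycle`).

Choosing such q_k inductively, every finite subsum of ∑ b(q_k) is close to a value of b, hence
bounded, although the terms stay away from zero (`containsCZero_of_cocycle`). By Bessaga–Pełczyński
(`containsCZero_of_bounded_sums`) the space contains c₀, a contradiction.

Existence of P comes from the idempotent in the minimal ideal of the compact commutative semigroup
obtained by strong operator closure. -/

namespace OrbitCompactness

open Filter Topology

/-! ### Bounded subsums and copies of c₀ -/

section CZero

/-- Rosenthal's lemma: a nonnegative matrix with bounded row sums has an infinite principal
submatrix whose off-diagonal row sums are small. -/
theorem exists_offDiagonal_sum_le {ε : ℝ} (hε : 0 ≤ ε) (n : ℕ) :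
    ∀ a : ℕ → ℕ → ℝ, (∀ i j, 0 ≤ a i j) → (∀ i (F : Finset ℕ), ∑ j ∈ F, a i j ≤ n * ε) →
      ∃ φ : ℕ → ℕ, Function.Injective φ ∧
        ∀ i (F : Finset ℕ), i ∉ F → ∑ j ∈ F, a (φ i) (φ j) ≤ ε := by
  induction n with
  | zero =>
    intro a _ h
    refine ⟨id, Function.injective_id, fun i F _ => (h i F).trans ?_⟩
    simpa using hε
  | succ n ih =>
    intro a ha h
    -- Pairing splits ℕ into infinitely many infinite blocks. Either one block works, or every block
    -- p has an index `i p` with mass more than ε on a finite set `F p` of the same block. The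
    -- transversal of these bad indices avoids that mass, so its row sums drop by ε.
    by_cases hp : ∃ p, ∀ i (F : Finset ℕ), i ∉ F →
        ∑ j ∈ F, a (Nat.pair p i) (Nat.pair p j) ≤ ε
    · obtain ⟨p, hp⟩ := hp
      exact ⟨Nat.pair p, fun i j hij => (Nat.pair_eq_pair.1 hij).2, hp⟩
    · push Not at hp
      choose i F hiF hF using hp
      obtain ⟨φ, hφ, hφ'⟩ := ih (fun p q => a (Nat.pair p (i p)) (Nat.pair q (i q)))
        (fun _ _ => ha _ _) (by
          intro p G
          have hd : Disjoint (G.image fun q => Nat.pair q (i q)) ((F p).image (Nat.pair p)) := by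
            rw [Finset.disjoint_left]
            intro k hk hk'
            obtain ⟨q, _, rfl⟩ := Finset.mem_image.1 hk
            obtain ⟨j, hj, hjq⟩ := Finset.mem_image.1 hk'
            obtain ⟨rfl, rfl⟩ := Nat.pair_eq_pair.1 hjq
            exact hiF _ hj
          have := h (Nat.pair p (i p)) ((G.image fun q => Nat.pair q (i q)) ∪
            ((F p).image (Nat.pair p)))
          rw [Finset.sum_union hd, Finset.sum_image, Finset.sum_image] at this
          · have h' := hF p
            push_cast at this
            linarith
          · intro x _ y _ hxy
            exact (Nat.pair_eq_pair.1 hxy).2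
          · intro x _ y _ hxy
            exact (Nat.pair_eq_pair.1 hxy).1)
      exact ⟨fun k => Nat.pair (φ k) (i (φ k)),
        fun x y hxy => hφ (Nat.pair_eq_pair.1 hxy).1, hφ'⟩

theorem sum_abs_le_of_forall_abs_sum_le {ι : Type*} {r : ι → ℝ} {C : ℝ}
    (h : ∀ F : Finset ι, |∑ i ∈ F, r i| ≤ C) (F : Finset ι) : ∑ i ∈ F, |r i| ≤ 2 * C := by
  have h1 : ∑ i ∈ F with 0 ≤ r i, |r i| = ∑ i ∈ F with 0 ≤ r i, r i :=
    Finset.sum_congr rfl fun i hi => abs_of_nonneg (Finset.mem_filter.1 hi).2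
  have h2 : ∑ i ∈ F with ¬ 0 ≤ r i, |r i| = -∑ i ∈ F with ¬ 0 ≤ r i, r i := by
    rw [← Finset.sum_neg_distrib]
    exact Finset.sum_congr rfl fun i hi =>
      abs_of_nonpos (le_of_lt (not_le.1 (Finset.mem_filter.1 hi).2))
  rw [← Finset.sum_filter_add_sum_filter_not F (fun i => 0 ≤ r i), h1, h2]
  have h3 := (abs_le.1 (h (F.filter fun i => 0 ≤ r i))).2
  have h4 := (abs_le.1 (h (F.filter fun i => ¬ 0 ≤ r i))).1
  linarith

variable {𝕜 : Type*} [RCLike 𝕜] {E : Type*} [NormedAddCommGroup E] [NormedSpace 𝕜 E]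

/-- Splitting a real sum by sign costs a factor 2; applying this to real and imaginary parts gives
4. -/
theorem sum_norm_dual_apply_le {x : ℕ → E} {C : ℝ}
    (hC : ∀ F : Finset ℕ, ‖∑ k ∈ F, x k‖ ≤ C) {f : StrongDual 𝕜 E} (hf : ‖f‖ ≤ 1)
    (F : Finset ℕ) : ∑ k ∈ F, ‖f (x k)‖ ≤ 4 * C := by
  have hfC : ∀ G : Finset ℕ, ‖∑ k ∈ G, f (x k)‖ ≤ C := fun G => by
    rw [← map_sum]
    exact (f.le_of_opNorm_le hf _).trans (by simpa using hC G)
  have hre := sum_abs_le_of_forall_abs_sum_le (r := fun k => RCLike.re (f (x k))) (C := C)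
    (fun G => by rw [← map_sum]; exact (RCLike.abs_re_le_norm _).trans (hfC G)) F
  have him := sum_abs_le_of_forall_abs_sum_le (r := fun k => RCLike.im (f (x k))) (C := C)
    (fun G => by rw [← map_sum]; exact (RCLike.abs_im_le_norm _).trans (hfC G)) F
  calc ∑ k ∈ F, ‖f (x k)‖
      ≤ ∑ k ∈ F, (|RCLike.re (f (x k))| + |RCLike.im (f (x k))|) :=
        Finset.sum_le_sum fun k _ => by
          conv_lhs => rw [← RCLike.re_add_im (f (x k))]
          refine (norm_add_le _ _).trans (add_le_add (RCLike.norm_ofReal _).le ?_)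
          rw [norm_mul, RCLike.norm_ofReal]
          exact mul_le_of_le_one_right (abs_nonneg _)
            (by rw [RCLike.norm_I]; split_ifs <;> norm_num)
    _ ≤ 4 * C := by rw [Finset.sum_add_distrib]; linarith

/-- A functional norming the sum reduces this to absolute summability of the scalar series. -/
theorem norm_sum_smul_le {x : ℕ → E} {C : ℝ} (hC : ∀ F : Finset ℕ, ‖∑ k ∈ F, x k‖ ≤ C)
    {a : ℕ → 𝕜} {F : Finset ℕ} {r : ℝ} (hr : 0 ≤ r) (ha : ∀ k ∈ F, ‖a k‖ ≤ r) :
    ‖∑ k ∈ F, a k • x k‖ ≤ 4 * C * r := by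
  obtain ⟨f, hf, hfx⟩ := exists_dual_vector'' 𝕜 (∑ k ∈ F, a k • x k)
  have h1 : ‖∑ k ∈ F, a k • x k‖ = ‖f (∑ k ∈ F, a k • x k)‖ := by
    rw [hfx, RCLike.norm_ofReal, abs_of_nonneg (norm_nonneg _)]
  rw [h1, map_sum]
  calc ‖∑ k ∈ F, f (a k • x k)‖ ≤ ∑ k ∈ F, r * ‖f (x k)‖ := by
        refine norm_sum_le_of_le _ fun k hk => ?_
        rw [map_smul, norm_smul]
        exact mul_le_mul_of_nonneg_right (ha k hk) (norm_nonneg _)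
    _ ≤ 4 * C * r := by
        rw [← Finset.mul_sum, mul_comm]
        exact mul_le_mul_of_nonneg_right (sum_norm_dual_apply_le hC hf F) hr

theorem summable_smul_of_tendsto_zero [CompleteSpace E] {x : ℕ → E} {C : ℝ}
    (hC : ∀ F : Finset ℕ, ‖∑ k ∈ F, x k‖ ≤ C) {a : ℕ → 𝕜} (ha : Tendsto a cofinite (𝓝 0)) :
    Summable fun k => a k • x k := by
  have hC0 : 0 ≤ C := by simpa using hC ∅
  rw [summable_iff_vanishing_norm]
  intro ε hε
  set r := ε / (4 * C + 1) with hr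
  have hr0 : 0 < r := by positivity
  have hfin : {k | ¬ ‖a k‖ < r}.Finite := by
    have := (tendsto_zero_iff_norm_tendsto_zero.1 ha).eventually (gt_mem_nhds hr0)
    simpa using this
  refine ⟨hfin.toFinset, fun F hF => ?_⟩
  have hb : ‖∑ k ∈ F, a k • x k‖ ≤ 4 * C * r := by
    refine norm_sum_smul_le hC hr0.le fun k hk => ?_
    by_contra hk'
    exact Finset.disjoint_left.1 hF hk (by simpa using (not_le.1 hk').le)
  have : (4 * C + 1) * r = ε := by rw [hr]; field_simp
  linarith

/-- Bessaga–Pełczyński: a weakly unconditionally Cauchy series whose terms stay away from zero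
produces a copy of `c₀`. -/
theorem containsCZero_of_bounded_sums [CompleteSpace E] {x : ℕ → E} {C δ : ℝ} (hδ : 0 < δ)
    (hx : ∀ k, δ ≤ ‖x k‖) (hC : ∀ F : Finset ℕ, ‖∑ k ∈ F, x k‖ ≤ C) : ContainsCZero 𝕜 E := by
  choose f hf hfx using fun k => exists_dual_vector'' 𝕜 (x k)
  obtain ⟨n, hn⟩ := exists_nat_ge (4 * C / (δ / 2))
  -- Along φ the norming functionals are almost biorthogonal: diagonal entries are at least δ,
  -- off-diagonal row sums at most δ/2.
  obtain ⟨φ, hφ, hoff⟩ := exists_offDiagonal_sum_le (ε := δ / 2) (by positivity) n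
    (fun i j => ‖f i (x j)‖) (fun _ _ => norm_nonneg _) (fun i F =>
      (sum_norm_dual_apply_le hC (hf i) F).trans ((div_le_iff₀ (by positivity)).1 hn))
  set y := x ∘ φ with hy
  have hyC : ∀ F : Finset ℕ, ‖∑ k ∈ F, y k‖ ≤ C := fun F => by
    have := hC (F.image φ)
    rwa [Finset.sum_image (fun _ _ _ _ h => hφ h)] at this
  have hC0 : 0 ≤ C := by simpa using hC ∅
  have hlim : ∀ a : C₀(ℕ, 𝕜), Tendsto a cofinite (𝓝 0) := fun a => by
    have := zero_at_infty a
    rwa [cocompact_eq_cofinite] at this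
  have hle : ∀ (a : C₀(ℕ, 𝕜)) k, ‖a k‖ ≤ ‖a‖ := fun a k => by
    rw [← ZeroAtInftyContinuousMap.norm_toBCF_eq_norm]
    exact a.toBCF.norm_coe_le_norm k
  have hsum : ∀ a : C₀(ℕ, 𝕜), Summable fun k => a k • y k := fun a =>
    summable_smul_of_tendsto_zero hyC (hlim a)
  let L : C₀(ℕ, 𝕜) →ₗ[𝕜] E :=
    { toFun := fun a => ∑' k, a k • y k
      map_add' := fun a b => by
        simp only [ZeroAtInftyContinuousMap.add_apply, add_smul]
        exact (hsum a).tsum_add (hsum b)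
      map_smul' := fun c a => by
        simp only [ZeroAtInftyContinuousMap.smul_apply, smul_assoc, RingHom.id_apply]
        exact (hsum a).tsum_const_smul c }
  have hup : ∀ a, ‖L a‖ ≤ 4 * C * ‖a‖ := fun a =>
    le_of_tendsto (hsum a).hasSum.norm
      (Eventually.of_forall fun F => norm_sum_smul_le hyC (norm_nonneg _) fun k _ => hle a k)
  -- Test L a against the functional norming the i-th vector. The supremum over i then absorbs half
  -- of the diagonal term and bounds L below by δ/2.
  have hlow : ∀ (a : C₀(ℕ, 𝕜)) i, ‖a i‖ * δ ≤ ‖L a‖ + ‖a‖ * (δ / 2) := fun a i => by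
    have h1 : ∀ F : Finset ℕ, i ∈ F → ‖a i‖ * δ ≤ ‖∑ k ∈ F, a k • y k‖ + ‖a‖ * (δ / 2) := by
      intro F hiF
      have h2 : f (φ i) (∑ k ∈ F, a k • y k) =
          a i * f (φ i) (x (φ i)) + ∑ k ∈ F.erase i, a k * f (φ i) (x (φ k)) := by
        rw [map_sum, ← Finset.add_sum_erase _ _ hiF]
        simp [hy]
      have h3 : ‖∑ k ∈ F.erase i, a k * f (φ i) (x (φ k))‖ ≤ ‖a‖ * (δ / 2) := by
        refine (norm_sum_le_of_le (f := fun k => a k * f (φ i) (x (φ k)))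
          (n := fun k => ‖a‖ * ‖f (φ i) (x (φ k))‖) _ fun k _ => ?_).trans ?_
        · rw [norm_mul]
          exact mul_le_mul_of_nonneg_right (hle a k) (norm_nonneg _)
        · rw [← Finset.mul_sum]
          exact mul_le_mul_of_nonneg_left (hoff i _ (Finset.notMem_erase i F)) (norm_nonneg _)
      have h4 : ‖f (φ i) (∑ k ∈ F, a k • y k)‖ ≤ ‖∑ k ∈ F, a k • y k‖ := by
        simpa using (f (φ i)).le_of_opNorm_le (hf _) (∑ k ∈ F, a k • y k)
      have h5 : ‖a i‖ * δ ≤ ‖a i * f (φ i) (x (φ i))‖ := by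
        rw [norm_mul, hfx, RCLike.norm_ofReal, abs_of_nonneg (norm_nonneg _)]
        exact mul_le_mul_of_nonneg_left (hx _) (norm_nonneg _)
      have h6 : a i * f (φ i) (x (φ i)) = f (φ i) (∑ k ∈ F, a k • y k) -
          ∑ k ∈ F.erase i, a k * f (φ i) (x (φ k)) := by rw [h2]; ring
      rw [h6] at h5
      have := norm_sub_le (f (φ i) (∑ k ∈ F, a k • y k))
        (∑ k ∈ F.erase i, a k * f (φ i) (x (φ k)))
      linarith
    refine ge_of_tendsto ((hsum a).hasSum.norm.add_const _) ?_
    filter_upwards [eventually_ge_atTop {i}] with F hF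
    exact h1 F (Finset.singleton_subset_iff.1 hF)
  have hlow' : ∀ a, ‖a‖ ≤ 2 / δ * ‖L a‖ := fun a => by
    have h1 : ‖a‖ ≤ (‖L a‖ + ‖a‖ * (δ / 2)) / δ := by
      rw [← ZeroAtInftyContinuousMap.norm_toBCF_eq_norm]
      refine (BoundedContinuousFunction.norm_le (by positivity)).2 fun i => ?_
      rw [le_div_iff₀ hδ, ZeroAtInftyContinuousMap.norm_toBCF_eq_norm]
      exact hlow a i
    rw [le_div_iff₀ hδ] at h1
    rw [div_mul_eq_mul_div, le_div_iff₀ hδ]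
    linarith
  have hinj : Function.Injective L := by
    refine (injective_iff_map_eq_zero L).2 fun a ha => norm_le_zero_iff.1 ?_
    simpa [ha] using hlow' a
  exact ⟨LinearMap.range L, ⟨(LinearEquiv.ofInjective L hinj).toContinuousLinearEquivOfBounds
    (4 * C) (2 / δ) hup fun z => by
      obtain ⟨a, rfl⟩ := (LinearEquiv.ofInjective L hinj).surjective z
      rw [LinearEquiv.symm_apply_apply]
      exact hlow' a⟩⟩

end CZero

/-! ### Bounded cocycles in spaces without c₀ -/

section Cocycle

theorem exists_separated_seq_of_not_totallyBounded {X : Type*} [PseudoMetricSpace X] {s : Set X}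
    (h : ¬ TotallyBounded s) :
    ∃ ε > 0, ∃ u : ℕ → X, (∀ n, u n ∈ s) ∧ ∀ i j, i < j → ε ≤ dist (u i) (u j) := by
  rw [Metric.totallyBounded_iff] at h
  push Not at h
  obtain ⟨ε, hε, h⟩ := h
  refine ⟨ε, hε, ?_⟩
  obtain ⟨u, hu, hu'⟩ := exists_seq_of_forall_finset_exists (fun x => x ∈ s)
    (fun x y => ε ≤ dist x y) (fun F _ => by
      obtain ⟨y, hys, hy⟩ := Set.not_subset.1 (h F F.finite_toSet)
      refine ⟨y, hys, fun x hx => ?_⟩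
      by_contra hxy
      refine hy (Set.mem_biUnion (Finset.mem_coe.2 hx) ?_)
      rw [Metric.mem_ball, dist_comm]
      exact not_le.1 hxy)
  exact ⟨u, hu, hu'⟩

variable {𝕜 : Type*} [RCLike 𝕜] {E : Type*} [NormedAddCommGroup E] [NormedSpace 𝕜 E]

/-- Finitely many relatively compact orbits can be brought simultaneously close to themselves along
any sequence. -/
theorem exists_lt_forall_norm_sub_le {M ι : Type*} {v : ι → M → E}
    (hv : ∀ i, IsCompact (closure (Set.range (v i)))) (V : Finset ι) {η : ℝ} (hη : 0 < η)
    (u : ℕ → M) : ∃ i j, i < j ∧ ∀ k ∈ V, ‖v k (u j) - v k (u i)‖ ≤ η := by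
  have hK : IsCompact (Set.pi Set.univ fun k : V => closure (Set.range (v k))) :=
    isCompact_univ_pi fun k => hv k
  obtain ⟨w, -, φ, hφ, hlim⟩ := hK.tendsto_subseq (x := fun n (k : V) => v k (u n))
    fun n k _ => subset_closure ⟨u n, rfl⟩
  obtain ⟨N, hN⟩ := Metric.cauchySeq_iff.1 hlim.cauchySeq η hη
  refine ⟨φ N, φ (N + 1), hφ N.lt_succ_self, fun k hk => ?_⟩
  rw [← dist_eq_norm]
  exact (dist_le_pi_dist (fun l : V => v l (u (φ (N + 1)))) (fun l : V => v l (u (φ N)))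
    ⟨k, hk⟩).trans (hN _ N.le_succ _ le_rfl).le

/-- If a bounded cocycle takes values of norm at least `ε` at elements acting almost trivially on
any prescribed finite set of values of the cocycle, then the space contains a copy of `c₀`. -/
theorem containsCZero_of_cocycle [CompleteSpace E] {M : Type*} [Monoid M] {ρ : M → E →L[𝕜] E}
    {b : M → E} (hb1 : b 1 = 0) (hb : ∀ g h, b (g * h) = b g + ρ g (b h)) {C : ℝ}
    (hC : ∀ g, ‖b g‖ ≤ C) {ε : ℝ} (hε : 0 < ε)
    (h : ∀ (V : Finset M) (η : ℝ), 0 < η →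
      ∃ g, ε ≤ ‖b g‖ ∧ ∀ w ∈ V, ‖ρ g (b w) - b w‖ ≤ η) :
    ContainsCZero 𝕜 E := by
  classical
  choose Q hQε hQ using fun (V : Finset M) (k : ℕ) => h V ((1 / 2) ^ k) (by positivity)
  -- `W k` collects the products of subfamilies of the first k chosen elements. The next one, `Q (W
  -- k) k`, moves each b(w) with w in `W k` by at most 2⁻ᵏ, so b is almost additive on these
  -- products.
  let W : ℕ → Finset M := fun n =>
    Nat.rec {1} (fun k V => V ∪ V.image (fun w => Q V k * w)) n
  have hW : ∀ k, W (k + 1) = W k ∪ (W k).image (fun w => Q (W k) k * w) := fun _ => rfl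
  have key : ∀ k (F : Finset ℕ), F ⊆ Finset.range k →
      ∃ w ∈ W k, ‖b w - ∑ i ∈ F, b (Q (W i) i)‖ ≤ ∑ i ∈ Finset.range k, (1 / 2 : ℝ) ^ i := by
    intro k
    induction k with
    | zero =>
      intro F hF
      obtain rfl : F = ∅ := by simpa using hF
      exact ⟨1, Finset.mem_singleton_self 1, by simp [hb1]⟩
    | succ k ih =>
      intro F hF
      obtain ⟨w, hw, hwF⟩ := ih (F.erase k) fun i hi => by
        have h1 := Finset.mem_range.1 (hF (Finset.mem_of_mem_erase hi))
        have h2 := Finset.ne_of_mem_erase hi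
        exact Finset.mem_range.2 (by omega)
      by_cases hk : k ∈ F
      · refine ⟨Q (W k) k * w, ?_, ?_⟩
        · rw [hW]
          exact Finset.mem_union_right _ (Finset.mem_image_of_mem _ hw)
        · have h1 : b (Q (W k) k * w) - ∑ i ∈ F, b (Q (W i) i) =
              (b w - ∑ i ∈ F.erase k, b (Q (W i) i)) + (ρ (Q (W k) k) (b w) - b w) := by
            rw [hb, ← Finset.add_sum_erase _ _ hk]
            abel
          rw [h1, Finset.sum_range_succ]
          exact (norm_add_le _ _).trans (add_le_add hwF (hQ _ _ w hw))
      · refine ⟨w, ?_, ?_⟩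
        · rw [hW]
          exact Finset.mem_union_left _ hw
        · rw [Finset.erase_eq_of_notMem hk] at hwF
          rw [Finset.sum_range_succ]
          exact hwF.trans (le_add_of_nonneg_right (by positivity))
  -- The 2 bounds the accumulated geometric error.
  refine containsCZero_of_bounded_sums (x := fun k => b (Q (W k) k)) (C := C + 2) hε
    (fun k => hQε _ _) fun F => ?_
  obtain ⟨n, hn⟩ := F.exists_nat_subset_range
  obtain ⟨w, -, hw⟩ := key n F hn
  have h1 := sum_geometric_two_le n
  have h2 := norm_sub_norm_le (∑ i ∈ F, b (Q (W i) i)) (b w)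
  rw [norm_sub_rev] at h2
  have := hC w
  linarith

/-- A bounded cocycle over an almost periodic representation which is bounded below has relatively
compact range, provided that the space does not contain `c₀`. -/
theorem totallyBounded_range_cocycle [CompleteSpace E] (hc0 : ¬ ContainsCZero 𝕜 E)
    {M : Type*} [Monoid M] {ρ : M → E →L[𝕜] E} {b : M → E} (hb1 : b 1 = 0)
    (hb : ∀ g h, b (g * h) = b g + ρ g (b h)) (hρ : ∀ g h v, ρ (g * h) v = ρ g (ρ h v))
    {C K : ℝ} (hC : ∀ g, ‖b g‖ ≤ C) (hK : ∀ g v, ‖ρ g v‖ ≤ K * ‖v‖)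
    (hlow : ∀ g h w, ‖ρ h (b w) - b w‖ ≤ K * ‖ρ g (ρ h (b w) - b w)‖)
    (hcpt : ∀ w, IsCompact (closure (Set.range fun g => ρ g (b w))))
    (hdvd : ∀ u : ℕ → M, ∃ φ : ℕ → ℕ, StrictMono φ ∧
      ∀ i j, i < j → ∃ q, u (φ j) = u (φ i) * q) :
    TotallyBounded (Set.range b) := by
  by_contra hnot
  obtain ⟨ε, hε, y, hy, hsep⟩ := exists_separated_seq_of_not_totallyBounded hnot
  choose u hu using hy
  obtain ⟨φ, hφ, hdiv⟩ := hdvd u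
  set K' := max K 1 with hK'
  have hK0 : 0 < K' := lt_max_of_lt_right one_pos
  have hKK : ∀ r : ℝ, 0 ≤ r → K * r ≤ K' * r := fun r hr =>
    mul_le_mul_of_nonneg_right (le_max_left _ _) hr
  refine hc0 (containsCZero_of_cocycle hb1 hb hC (ε := ε / K') (by positivity) fun V η hη => ?_)
  obtain ⟨i, j, hij, hV⟩ := exists_lt_forall_norm_sub_le (v := fun w g => ρ g (b w)) hcpt V
    (η := η / K') (by positivity) (u ∘ φ)
  obtain ⟨q, hq⟩ := hdiv i j hij
  refine ⟨q, ?_, fun w hw => ?_⟩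
  -- The cocycle identity gives b(u_i) - b(u_j) = -ρ(u_i) b(q); the upper bound on ρ(u_i) keeps b(q)
  -- large.
  · have h1 := hsep _ _ (hφ hij)
    rw [← hu, ← hu, dist_eq_norm, hq, hb, sub_add_cancel_left, norm_neg] at h1
    rw [div_le_iff₀' hK0]
    exact (h1.trans (hK _ _)).trans (hKK _ (norm_nonneg _))
  -- Here ρ(u_j) b(w) - ρ(u_i) b(w) = ρ(u_i)(ρ(q) b(w) - b(w)), and the lower bound cancels ρ(u_i).
  · have h1 := hV w hw
    simp only [Function.comp_apply] at h1
    rw [hq, hρ, ← map_sub, le_div_iff₀' hK0] at h1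
    exact ((hlow _ _ _).trans (hKK _ (norm_nonneg _))).trans h1

end Cocycle

/-! ### The Jacobs–de Leeuw–Glicksberg projection -/

section JdLG

/-- The idempotent of the minimal ideal of a compact commutative semigroup. -/
theorem exists_idempotent_forall_exists_mul_eq {Y : Type*} [Semigroup Y] [TopologicalSpace Y]
    [T2Space Y] (hcont : ∀ r : Y, Continuous (· * r)) {G : Set Y} (hG : IsCompact G)
    (hne : G.Nonempty) (hmul : ∀ g ∈ G, ∀ h ∈ G, g * h ∈ G)
    (hcomm : ∀ g ∈ G, ∀ h ∈ G, g * h = h * g) :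
    ∃ e ∈ G, e * e = e ∧ ∀ g ∈ G, ∃ h ∈ G, g * h = e := by
  have : Nonempty G := hne.to_subtype
  have hI : ∀ g : G, IsCompact ((· * (g : Y)) '' G) := fun g => hG.image (hcont g)
  -- The principal ideals Gg are compact and, by commutativity, directed downwards, since G(gh) lies
  -- in both Gg and Gh. Any idempotent in their intersection is a multiple of every g.
  have hKne : (⋂ g : G, (· * (g : Y)) '' G).Nonempty := by
    refine IsCompact.nonempty_iInter_of_directed_nonempty_isCompact_isClosed _ ?_
      (fun g => hne.image _) hI (fun g => (hI g).isClosed)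
    rintro ⟨g, hg⟩ ⟨h, hh⟩
    refine ⟨⟨g * h, hmul g hg h hh⟩, ?_, ?_⟩
    · rintro _ ⟨k, hk, rfl⟩
      refine ⟨k * h, hmul k hk h hh, ?_⟩
      simp only [mul_assoc, hcomm g hg h hh]
    · rintro _ ⟨k, hk, rfl⟩
      exact ⟨k * g, hmul k hk g hg, mul_assoc _ _ _⟩
  have hKG : ∀ k ∈ ⋂ g : G, (· * (g : Y)) '' G, k ∈ G := fun k hk => by
    obtain ⟨h, hh, rfl⟩ := Set.mem_iInter.1 hk (Classical.arbitrary G)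
    exact hmul h hh _ (Subtype.property _)
  obtain ⟨e, he, hee⟩ := exists_idempotent_in_compact_subsemigroup hcont _ hKne
    ((hI (Classical.arbitrary G)).of_isClosed_subset
      (isClosed_iInter fun g => (hI g).isClosed) (Set.iInter_subset _ _)) (fun k hk l hl => by
      refine Set.mem_iInter.2 fun g => ?_
      obtain ⟨h, hh, rfl⟩ := Set.mem_iInter.1 hl g
      exact ⟨k * h, hmul k (hKG k hk) h hh, mul_assoc _ _ _⟩)
  refine ⟨e, hKG e he, hee, fun g hg => ?_⟩
  obtain ⟨h, hh, hhe⟩ := Set.mem_iInter.1 he ⟨g, hg⟩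
  exact ⟨h, hh, (hcomm g hg h hh).trans hhe⟩

variable {𝕜 : Type*} [RCLike 𝕜] {X : Type*} [NormedAddCommGroup X] [NormedSpace 𝕜 X]

theorem subset_sotClosure (𝒯 : Set (X →L[𝕜] X)) : 𝒯 ⊆ sotClosure 𝒯 := fun A hA =>
  show toSOT A ∈ closure (toSOT '' 𝒯) from subset_closure (Set.mem_image_of_mem _ hA)

theorem toSOT_image_sotClosure (𝒯 : Set (X →L[𝕜] X)) :
    toSOT '' sotClosure 𝒯 = closure (toSOT '' 𝒯) :=
  Set.image_preimage_eq _ toSOT.surjective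

/-- Properties which define a closed set for the strong operator topology pass to the closure. -/
theorem sotClosure_induction {𝒯 : Set (X →L[𝕜] X)} {p : (X →L[𝕜] X) → Prop}
    (hp : IsClosed {A : X →Lₚₜ[𝕜] X | p (toSOT.symm A)}) (h : ∀ A ∈ 𝒯, p A)
    {A : X →L[𝕜] X} (hA : A ∈ sotClosure 𝒯) : p A := by
  have : toSOT '' 𝒯 ⊆ {A : X →Lₚₜ[𝕜] X | p (toSOT.symm A)} := by
    rintro _ ⟨B, hB, rfl⟩
    exact h B hB
  exact closure_minimal this hp hA

theorem continuous_sot_mul_right (R : X →L[𝕜] X) :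
    Continuous fun A : X →Lₚₜ[𝕜] X => toSOT (toSOT.symm A * R) :=
  PointwiseConvergenceCLM.continuous_of_continuous_eval fun x =>
    continuous_eval_const (F := X →Lₚₜ[𝕜] X) (R x)

theorem continuous_sot_mul_left (R : X →L[𝕜] X) :
    Continuous fun A : X →Lₚₜ[𝕜] X => toSOT (R * toSOT.symm A) :=
  PointwiseConvergenceCLM.continuous_of_continuous_eval fun x =>
    R.continuous.comp (continuous_eval_const (F := X →Lₚₜ[𝕜] X) x)

theorem norm_apply_le_of_mem_sotClosure {𝒯 : Set (X →L[𝕜] X)} {M : ℝ}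
    (hM : ∀ A ∈ 𝒯, ∀ x, ‖A x‖ ≤ M * ‖x‖) {A : X →L[𝕜] X} (hA : A ∈ sotClosure 𝒯) (x : X) :
    ‖A x‖ ≤ M * ‖x‖ := by
  refine sotClosure_induction (p := fun A => ‖A x‖ ≤ M * ‖x‖) ?_ (fun A hA => hM A hA x) hA
  exact isClosed_le (continuous_eval_const (F := X →Lₚₜ[𝕜] X) x).norm continuous_const

theorem commute_of_mem_sotClosure {𝒯 : Set (X →L[𝕜] X)}
    (hcomm : ∀ A ∈ 𝒯, ∀ B ∈ 𝒯, A * B = B * A) {A B : X →L[𝕜] X} (hA : A ∈ sotClosure 𝒯)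
    (hB : B ∈ sotClosure 𝒯) : A * B = B * A := by
  have hclosed : ∀ C : X →L[𝕜] X,
      IsClosed {A : X →Lₚₜ[𝕜] X | toSOT.symm A * C = C * toSOT.symm A} := fun C => by
    have := isClosed_eq (continuous_sot_mul_right C) (continuous_sot_mul_left C)
    simpa only [toSOT.apply_eq_iff_eq] using this
  refine sotClosure_induction (p := fun A => A * B = B * A) (hclosed B) (fun A hA => ?_) hA
  exact (sotClosure_induction (p := fun B => B * A = A * B) (hclosed A)
    (fun B hB => hcomm B hB A hA) hB).symm

theorem mul_mem_sotClosure {𝒯 : Set (X →L[𝕜] X)} (hmul : ∀ A ∈ 𝒯, ∀ B ∈ 𝒯, A * B ∈ 𝒯)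
    {A B : X →L[𝕜] X} (hA : A ∈ sotClosure 𝒯) (hB : B ∈ sotClosure 𝒯) :
    A * B ∈ sotClosure 𝒯 := by
  refine sotClosure_induction (p := fun A => A * B ∈ sotClosure 𝒯)
    (isClosed_closure.preimage (continuous_sot_mul_right B)) (fun A hA => ?_) hA
  exact sotClosure_induction (p := fun B => A * B ∈ sotClosure 𝒯)
    (isClosed_closure.preimage (continuous_sot_mul_left A))
    (fun B hB => subset_sotClosure _ (hmul A hA B hB)) hB

/-- Tychonoff on the product of orbit closures: linearity and the uniform bound survive pointwise
limits, so a limit function is again a bounded operator. -/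
theorem isCompact_sotClosure {𝒯 : Set (X →L[𝕜] X)} {M : ℝ}
    (hM : ∀ A ∈ 𝒯, ∀ x, ‖A x‖ ≤ M * ‖x‖)
    (horb : ∀ x, IsCompact (closure ((fun A : X →L[𝕜] X => A x) '' 𝒯))) :
    IsCompact (toSOT '' sotClosure 𝒯) := by
  rw [toSOT_image_sotClosure]
  set L : Set (X → X) := {f | (∀ x y, f (x + y) = f x + f y) ∧ (∀ (c : 𝕜) x, f (c • x) = c • f x) ∧
    ∀ x, ‖f x‖ ≤ M * ‖x‖} with hL
  have hLc : IsClosed L := by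
    have hev : ∀ x : X, Continuous fun f : X → X => f x := continuous_apply
    simp only [hL, Set.ofPred_and, Set.ofPred_forall]
    refine IsClosed.inter ?_ (IsClosed.inter ?_ ?_)
    · exact isClosed_iInter fun x => isClosed_iInter fun y =>
        isClosed_eq (hev _) ((hev x).add (hev y))
    · exact isClosed_iInter fun c => isClosed_iInter fun x =>
        isClosed_eq (hev _) ((hev x).const_smul c)
    · exact isClosed_iInter fun x => isClosed_le (hev x).norm continuous_const
  have hcpt : IsCompact
      ((Set.pi Set.univ fun x => closure ((fun A : X →L[𝕜] X => A x) '' 𝒯)) ∩ L) :=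
    (isCompact_univ_pi horb).inter_right hLc
  set D : Set (X →Lₚₜ[𝕜] X) := {A | (∀ x, A x ∈ closure ((fun A : X →L[𝕜] X => A x) '' 𝒯)) ∧
    ∀ x, ‖A x‖ ≤ M * ‖x‖} with hD
  have hDc : IsCompact D := by
    rw [(PointwiseConvergenceCLM.isEmbedding_coeFn (RingHom.id 𝕜) X X).isCompact_iff]
    convert hcpt using 1
    ext f
    constructor
    · rintro ⟨A, ⟨h1, h2⟩, rfl⟩
      exact ⟨fun x _ => h1 x, map_add A, map_smul A, h2⟩
    · rintro ⟨h1, h2, h3, h4⟩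
      exact ⟨toSOT (LinearMap.mkContinuous ⟨⟨f, h2⟩, h3⟩ M h4),
        ⟨fun x => h1 x (Set.mem_univ x), h4⟩, rfl⟩
  refine hDc.of_isClosed_subset isClosed_closure (closure_minimal ?_ hDc.isClosed)
  rintro _ ⟨A, hA, rfl⟩
  exact ⟨fun x => subset_closure ⟨A, hA, rfl⟩, hM A hA⟩

/-- A bounded group of operators which is compact for the strong operator topology is
a topological group. -/
theorem isCompactOperatorGroup_of_isCompact {G : Set (X →L[𝕜] X)} {M : ℝ}
    (hM : ∀ A ∈ G, ∀ x, ‖A x‖ ≤ M * ‖x‖) (hone : 1 ∈ G) (hmul : ∀ A ∈ G, ∀ B ∈ G, A * B ∈ G)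
    (hinv : ∀ A ∈ G, ∃ B ∈ G, A * B = 1 ∧ B * A = 1) (hG : IsCompact (toSOT '' G)) :
    IsCompactOperatorGroup G where
  one_mem := hone
  mul_mem := hmul
  exists_inv := hinv
  isCompact := hG
  continuousOn_mul := by
    rintro ⟨_, _⟩ ⟨⟨A, hA, rfl⟩, ⟨B, hB, rfl⟩⟩
    refine PointwiseConvergenceCLM.tendsto_iff_forall_tendsto.2 fun x => ?_
    set l := 𝓝[(toSOT '' G) ×ˢ (toSOT '' G)] (toSOT A, toSOT B) with hl
    have h1 : Tendsto (fun p : (X →Lₚₜ[𝕜] X) × (X →Lₚₜ[𝕜] X) => p.1 (B x)) l (𝓝 (A (B x))) :=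
      (((continuous_eval_const (F := X →Lₚₜ[𝕜] X) (B x)).comp continuous_fst).tendsto
        (toSOT A, toSOT B)).mono_left nhdsWithin_le_nhds
    have h2 : Tendsto (fun p : (X →Lₚₜ[𝕜] X) × (X →Lₚₜ[𝕜] X) => p.2 x) l (𝓝 (B x)) :=
      (((continuous_eval_const (F := X →Lₚₜ[𝕜] X) x).comp continuous_snd).tendsto
        (toSOT A, toSOT B)).mono_left nhdsWithin_le_nhds
    -- The uniform bound gives joint continuity: split p.1 (p.2 x) as p.1 (p.2 x - B x) + p.1 (B x).
    have h3 : Tendsto (fun p : (X →Lₚₜ[𝕜] X) × (X →Lₚₜ[𝕜] X) => p.1 (p.2 x - B x)) l (𝓝 0) := by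
      refine squeeze_zero_norm' (a := fun p => M * ‖p.2 x - B x‖) ?_ ?_
      · filter_upwards [self_mem_nhdsWithin] with p hp
        obtain ⟨C, hC, hCp⟩ := hp.1
        rw [← hCp]
        exact hM C hC _
      · simpa using ((h2.sub_const (B x)).norm).const_mul M
    have h4 := h3.add h1
    rw [zero_add] at h4
    refine h4.congr fun p => ?_
    rw [map_sub, sub_add_cancel]
    rfl
  continuousOn_inv := by
    have hinv' : ∀ A ∈ G, Ring.inverse A ∈ G ∧ A * Ring.inverse A = 1 ∧ Ring.inverse A * A = 1 := by
      intro A hA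
      obtain ⟨B, hB, hAB, hBA⟩ := hinv A hA
      have : Ring.inverse A = B := Ring.inverse_unit (⟨A, B, hAB, hBA⟩ : (X →L[𝕜] X)ˣ)
      rw [this]
      exact ⟨hB, hAB, hBA⟩
    rintro _ ⟨A, hA, rfl⟩
    refine PointwiseConvergenceCLM.tendsto_iff_forall_tendsto.2 fun x => ?_
    set l := 𝓝[toSOT '' G] (toSOT A) with hl
    set y := Ring.inverse A x with hy
    have hAy : A y = x := by
      rw [hy, ← mul_apply_eq_comp, (hinv' A hA).2.1]
      rfl
    have h1 : Tendsto (fun B : X →Lₚₜ[𝕜] X => B y) l (𝓝 (A y)) :=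
      ((continuous_eval_const (F := X →Lₚₜ[𝕜] X) y).tendsto (toSOT A)).mono_left
        nhdsWithin_le_nhds
    rw [tendsto_iff_norm_sub_tendsto_zero]
    refine squeeze_zero' (g := fun B : X →Lₚₜ[𝕜] X => M * ‖B y - A y‖)
      (Eventually.of_forall fun _ => norm_nonneg _) ?_ ?_
    · filter_upwards [self_mem_nhdsWithin] with p hp
      obtain ⟨B, hB, rfl⟩ := hp
      have h2 : Ring.inverse B (B y) = y := by
        rw [← mul_apply_eq_comp, (hinv' B hB).2.2]
        rfl
      have h3 : Ring.inverse B x - y = - Ring.inverse B (B y - A y) := by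
        rw [map_sub, h2, hAy]
        abel
      have h4 := hM _ (hinv' B hB).1 (B y - A y)
      rw [← norm_neg, ← h3] at h4
      exact h4
    · simpa using ((h1.sub_const (A y)).norm).const_mul M

/-- On the range of P, Q restricts to an idempotent of a group, hence to the identity, so QP = P.
Exchange the roles and use commutativity. -/
theorem eq_of_isJdLGProjection {𝒯 : Set (X →L[𝕜] X)}
    (hcomm : ∀ A ∈ 𝒯, ∀ B ∈ 𝒯, A * B = B * A) {P Q : X →L[𝕜] X} (hP : IsJdLGProjection 𝒯 P)
    (hQ : IsJdLGProjection 𝒯 Q) : P = Q := by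
  have key : ∀ {P Q : X →L[𝕜] X}, IsJdLGProjection 𝒯 P → IsJdLGProjection 𝒯 Q → Q * P = P := by
    intro P Q hP hQ
    have hPQ := commute_of_mem_sotClosure hcomm hP.mem_sotClosure hQ.mem_sotClosure
    have hmaps : ∀ y ∈ LinearMap.range (P : X →ₗ[𝕜] X), Q y ∈ LinearMap.range (P : X →ₗ[𝕜] X) := by
      rintro _ ⟨z, rfl⟩
      exact ⟨Q z, DFunLike.congr_fun hPQ z⟩
    obtain ⟨B, -, -, hBA⟩ := hP.group_on_range.exists_inv (Q.restrict hmaps)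
      ⟨Q, hQ.mem_sotClosure, fun _ => rfl⟩
    have hidem : Q.restrict hmaps * Q.restrict hmaps = Q.restrict hmaps := by
      ext y
      exact DFunLike.congr_fun hQ.isIdempotentElem (y : X)
    have hone : Q.restrict hmaps = 1 := by
      calc Q.restrict hmaps = (B * Q.restrict hmaps) * Q.restrict hmaps := by rw [hBA, one_mul]
        _ = 1 := by rw [mul_assoc, hidem, hBA]
    ext x
    exact congrArg Subtype.val (DFunLike.congr_fun hone ⟨P x, x, rfl⟩)
  rw [← key hP hQ, ← commute_of_mem_sotClosure hcomm hP.mem_sotClosure hQ.mem_sotClosure, key hQ hP]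

theorem apply_mem_range_of_commute {P A : X →L[𝕜] X} (h : A * P = P * A) :
    ∀ y ∈ LinearMap.range (P : X →ₗ[𝕜] X), A y ∈ LinearMap.range (P : X →ₗ[𝕜] X) := by
  rintro _ ⟨z, rfl⟩
  exact ⟨A z, (DFunLike.congr_fun h z).symm⟩

/-- The Jacobs–de Leeuw–Glicksberg projection of a bounded commutative semigroup of operators with
relatively compact orbits. -/
theorem existsUnique_isJdLGProjection {𝒯 : Set (X →L[𝕜] X)} (hne : 𝒯.Nonempty)
    (hmul : ∀ A ∈ 𝒯, ∀ B ∈ 𝒯, A * B ∈ 𝒯) (hcomm : ∀ A ∈ 𝒯, ∀ B ∈ 𝒯, A * B = B * A) {M : ℝ}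
    (hM : ∀ A ∈ 𝒯, ∀ x, ‖A x‖ ≤ M * ‖x‖)
    (horb : ∀ x, IsCompact (closure ((fun A : X →L[𝕜] X => A x) '' 𝒯))) :
    ∃! P, IsJdLGProjection 𝒯 P := by
  have hcpt := isCompact_sotClosure hM horb
  have hcomm' : ∀ A ∈ sotClosure 𝒯, ∀ B ∈ sotClosure 𝒯, A * B = B * A := fun A hA B hB =>
    commute_of_mem_sotClosure hcomm hA hB
  have hmul' : ∀ A ∈ sotClosure 𝒯, ∀ B ∈ sotClosure 𝒯, A * B ∈ sotClosure 𝒯 := fun A hA B hB =>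
    mul_mem_sotClosure hmul hA hB
  obtain ⟨P, hPc, hPP, hPinv⟩ : ∃ P ∈ sotClosure 𝒯, P * P = P ∧
      ∀ A ∈ sotClosure 𝒯, ∃ B ∈ sotClosure 𝒯, A * B = P := by
    let _ : Semigroup (X →Lₚₜ[𝕜] X) :=
      { mul := fun A B => toSOT (toSOT.symm A * toSOT.symm B)
        mul_assoc := fun _ _ _ => rfl }
    obtain ⟨_, ⟨P, hP, rfl⟩, hPP, h⟩ := exists_idempotent_forall_exists_mul_eq
      (Y := X →Lₚₜ[𝕜] X) (fun R => continuous_sot_mul_right (toSOT.symm R)) hcpt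
      (hne.mono (subset_sotClosure 𝒯) |>.image _)
      (by
        rintro _ ⟨A, hA, rfl⟩ _ ⟨B, hB, rfl⟩
        exact ⟨A * B, hmul' A hA B hB, rfl⟩)
      (by
        rintro _ ⟨A, hA, rfl⟩ _ ⟨B, hB, rfl⟩
        exact congrArg toSOT (hcomm' A hA B hB))
    refine ⟨P, hP, toSOT.injective hPP, fun A hA => ?_⟩
    obtain ⟨_, ⟨B, hB, rfl⟩, hAB⟩ := h _ ⟨A, hA, rfl⟩
    exact ⟨B, hB, toSOT.injective hAB⟩
  have hPy : ∀ y : LinearMap.range (P : X →ₗ[𝕜] X), P (y : X) = y := by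
    rintro ⟨_, z, rfl⟩
    exact DFunLike.congr_fun hPP z
  have hmaps : ∀ A ∈ sotClosure 𝒯, ∀ y ∈ LinearMap.range (P : X →ₗ[𝕜] X),
      A y ∈ LinearMap.range (P : X →ₗ[𝕜] X) := fun A hA =>
    apply_mem_range_of_commute (hcomm' A hA P hPc)
  have hP : IsJdLGProjection 𝒯 P := by
    -- P itself is the element of the closure that vanishes on its kernel.
    refine ⟨hPc, hPP, ?_, P, hPc, fun y => (LinearMap.mem_ker.1 y.2).symm⟩
    refine isCompactOperatorGroup_of_isCompact (M := M) ?_ ⟨P, hPc, fun y => (hPy y).symm⟩ ?_ ?_ ?_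
    · rintro A ⟨R, hR, hAR⟩ y
      have := norm_apply_le_of_mem_sotClosure hM hR y
      rwa [← hAR] at this
    · rintro A ⟨R, hR, hAR⟩ B ⟨Q, hQ, hBQ⟩
      exact ⟨R * Q, hmul' R hR Q hQ, fun y => by
        rw [mul_apply_eq_comp, hAR, hBQ, mul_apply_eq_comp]⟩
    · rintro A ⟨R, hR, hAR⟩
      obtain ⟨Q, hQ, hRQ⟩ := hPinv R hR
      refine ⟨Q.restrict (hmaps Q hQ), ⟨Q, hQ, fun _ => rfl⟩, ?_, ?_⟩
      · ext y
        rw [mul_apply_eq_comp, hAR]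
        exact (DFunLike.congr_fun hRQ (y : X)).trans (hPy y)
      · ext y
        rw [hcomm' R hR Q hQ] at hRQ
        refine Eq.trans ?_ ((DFunLike.congr_fun hRQ (y : X)).trans (hPy y))
        exact congrArg Q (hAR y)
    -- Compression by P is continuous on all operators and agrees with restriction on the closure,
    -- so the group is a continuous image of a compact set.
    · let r : (X →Lₚₜ[𝕜] X) → (LinearMap.range (P : X →ₗ[𝕜] X) →Lₚₜ[𝕜]
          LinearMap.range (P : X →ₗ[𝕜] X)) := fun A =>
        toSOT (((P.codRestrict (LinearMap.range (P : X →ₗ[𝕜] X)) fun x => ⟨x, rfl⟩).comp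
          (toSOT.symm A)).comp (LinearMap.range (P : X →ₗ[𝕜] X)).subtypeL)
      have hr : Continuous r :=
        PointwiseConvergenceCLM.continuous_of_continuous_eval fun x =>
          (P.codRestrict (LinearMap.range (P : X →ₗ[𝕜] X)) fun x => ⟨x, rfl⟩).continuous.comp
            (continuous_eval_const (F := X →Lₚₜ[𝕜] X) (x : X))
      have hrA : ∀ A ∈ sotClosure 𝒯, ∀ y, (r (toSOT A) y : X) = A y := fun A hA y =>
        hPy ⟨A y, hmaps A hA y y.2⟩
      convert hcpt.image hr using 1
      ext B
      constructor
      · rintro ⟨B, ⟨A, hA, hBA⟩, rfl⟩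
        refine ⟨toSOT A, ⟨A, hA, rfl⟩, ?_⟩
        ext y
        exact (hrA A hA y).trans (hBA y).symm
      · rintro ⟨_, ⟨A, hA, rfl⟩, rfl⟩
        exact ⟨toSOT.symm (r (toSOT A)), ⟨A, hA, hrA A hA⟩, rfl⟩
  exact ⟨P, hP, fun Q hQ => eq_of_isJdLGProjection hcomm hQ hP⟩

end JdLG

/-! ### Monomials in commuting generators -/

section GeneratedSemigroup

variable {𝕜 : Type*} [RCLike 𝕜] {E : Type*} [NormedAddCommGroup E] [NormedSpace 𝕜 E]

theorem eq_one_or_mem_of_mem_submonoid_closure {N : Type*} [Monoid N] {s : Set N} {a : N}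
    (ha : a ∈ Submonoid.closure s) : a = 1 ∨ a ∈ Subsemigroup.closure s := by
  induction ha using Submonoid.closure_induction with
  | mem x hx => exact Or.inr (Subsemigroup.subset_closure hx)
  | one => exact Or.inl rfl
  | mul x y _ _ ihx ihy =>
    rcases ihx with rfl | hx
    · simpa using ihy
    · rcases ihy with rfl | hy
      · simpa using Or.inr hx
      · exact Or.inr (mul_mem hx hy)

theorem mem_submonoid_closure_of_mem {N : Type*} [Monoid N] {s : Set N} {a : N}
    (ha : a ∈ Subsemigroup.closure s) : a ∈ Submonoid.closure s := by
  induction ha using Subsemigroup.closure_induction with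
  | mem x hx => exact Submonoid.subset_closure hx
  | mul x y _ _ ihx ihy => exact mul_mem ihx ihy

open scoped IsMulCommutative in
/-- Every element of a monoid generated by commuting elements `t₁, …, tₘ` is a monomial in the
generators. -/
theorem exists_eq_prod_pow {N : Type*} [Monoid N] {m : ℕ} (t : Fin m → N)
    [IsMulCommutative (Submonoid.closure (Set.range t))] (a : Submonoid.closure (Set.range t)) :
    ∃ n : Fin m → ℕ, a = ∏ j, (⟨t j, Submonoid.subset_closure ⟨j, rfl⟩⟩ :
      Submonoid.closure (Set.range t)) ^ n j := by
  have ha : a ∈ Submonoid.closure (Set.range fun j => (⟨t j, Submonoid.subset_closure ⟨j, rfl⟩⟩ :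
      Submonoid.closure (Set.range t))) := by
    have : (Set.range fun j => (⟨t j, Submonoid.subset_closure ⟨j, rfl⟩⟩ :
        Submonoid.closure (Set.range t))) = (↑) ⁻¹' Set.range t := by
      ext b
      simp [Subtype.ext_iff]
    rw [this, Submonoid.closure_closure_coe_preimage]
    exact Submonoid.mem_top a
  obtain ⟨n, hn⟩ := Submonoid.exists_of_mem_closure_range _ _ ha
  exact ⟨n, hn⟩

theorem isMulCommutative_closure_range {N : Type*} [Monoid N] {m : ℕ} {t : Fin m → N}
    (hcomm : ∀ i j, Commute (t i) (t j)) :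
    IsMulCommutative (Submonoid.closure (Set.range t)) :=
  Submonoid.isMulCommutative_closure _ (by
    rintro _ ⟨i, rfl⟩ _ ⟨j, rfl⟩
    exact hcomm i j)

open scoped IsMulCommutative in
/-- Dickson's lemma for a monoid generated by finitely many commuting elements. -/
theorem exists_strictMono_forall_eq_mul {N : Type*} [Monoid N] {m : ℕ} {t : Fin m → N}
    (hcomm : ∀ i j, Commute (t i) (t j)) (u : ℕ → Submonoid.closure (Set.range t)) :
    ∃ φ : ℕ → ℕ, StrictMono φ ∧ ∀ i j, i < j → ∃ q, u (φ j) = u (φ i) * q := by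
  have := isMulCommutative_closure_range hcomm
  choose n hn using fun k => exists_eq_prod_pow t (u k)
  -- Exponent vectors in ℕᵐ are well-quasi-ordered, and componentwise order yields divisibility.
  obtain ⟨g, hg⟩ := (wellQuasiOrdered_le (α := Fin m → ℕ)).exists_monotone_subseq n
  refine ⟨g, g.strictMono, fun i j hij => ?_⟩
  obtain ⟨k, hk⟩ := exists_add_of_le (hg i j hij.le)
  refine ⟨∏ j, (⟨t j, Submonoid.subset_closure ⟨j, rfl⟩⟩ :
    Submonoid.closure (Set.range t)) ^ k j, ?_⟩
  rw [hn, hn, ← Finset.prod_mul_distrib, hk]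
  simp only [Pi.add_apply, pow_add]

open scoped IsMulCommutative in
theorem exists_norm_le_of_isPowerBounded {m : ℕ} {T : Fin m → E →L[𝕜] E}
    (hcomm : ∀ i j, Commute (T i) (T j)) (hpb : ∀ j, IsPowerBounded (T j)) :
    ∃ M : ℝ, ∀ R ∈ Submonoid.closure (Set.range T), ‖R‖ ≤ M := by
  have := isMulCommutative_closure_range hcomm
  choose C hC using hpb
  have key : ∀ s : Finset (Fin m), ∃ M : ℝ, ∀ n : Fin m → ℕ,
      ‖((∏ j ∈ s, (⟨T j, Submonoid.subset_closure ⟨j, rfl⟩⟩ :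
        Submonoid.closure (Set.range T)) ^ n j : Submonoid.closure (Set.range T)) : E →L[𝕜] E)‖
        ≤ M := by
    intro s
    induction s using Finset.induction_on with
    | empty => exact ⟨‖(1 : E →L[𝕜] E)‖, fun n => by simp⟩
    | insert i s hi ih =>
      obtain ⟨M, hM⟩ := ih
      refine ⟨C i * M, fun n => ?_⟩
      rw [Finset.prod_insert hi]
      exact (norm_mul_le _ _).trans (mul_le_mul (hC i _) (hM n) (norm_nonneg _)
        ((norm_nonneg _).trans (hC i 0)))
  obtain ⟨M, hM⟩ := key Finset.univ
  refine ⟨M, fun R hR => ?_⟩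
  obtain ⟨n, hn⟩ := exists_eq_prod_pow T ⟨R, hR⟩
  have := hM n
  rwa [← hn] at this

end GeneratedSemigroup

/-! ### The projection on the almost periodic part -/

section Closed

variable {𝕜 : Type*} [RCLike 𝕜] {E : Type*} [NormedAddCommGroup E] [NormedSpace 𝕜 E]

theorem relCompact_iff_totallyBounded [CompleteSpace E] {A : Set E} :
    RelCompact A ↔ TotallyBounded A :=
  ⟨fun h => h.totallyBounded.subset subset_closure, fun h =>
    h.closure.isCompact_of_isClosed isClosed_closure⟩

/-- By uniform boundedness, orbits of nearby vectors stay uniformly close, so a net for one serves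
the other. -/
theorem isClosed_aap [CompleteSpace E] {S : Subsemigroup (E →L[𝕜] E)} {M : ℝ}
    (hM : ∀ R ∈ S, ∀ x, ‖R x‖ ≤ M * ‖x‖) : IsClosed (aap S : Set E) := by
  refine isClosed_of_closure_subset fun x hx => ?_
  refine relCompact_iff_totallyBounded.2 (Metric.totallyBounded_iff.2 fun ε hε => ?_)
  set K := max M 1 with hKdef
  have hK : 0 < K := lt_max_of_lt_right one_pos
  obtain ⟨y, hy, hxy⟩ := Metric.mem_closure_iff.1 hx (ε / 2 / K) (by positivity)
  obtain ⟨t, ht, hyt⟩ := Metric.totallyBounded_iff.1 (relCompact_iff_totallyBounded.1 hy) (ε / 2)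
    (by positivity)
  refine ⟨t, ht, ?_⟩
  rintro _ ⟨R, hR, rfl⟩
  obtain ⟨z, hz, hRz⟩ := Set.mem_iUnion₂.1 (hyt ⟨R, hR, rfl⟩)
  refine Set.mem_iUnion₂.2 ⟨z, hz, ?_⟩
  rw [Metric.mem_ball] at hRz ⊢
  have h1 : dist (R x) (R y) < ε / 2 := by
    rw [dist_eq_norm, ← map_sub]
    refine (hM R hR _).trans_lt ((mul_le_mul_of_nonneg_right (le_max_left M 1)
      (norm_nonneg _)).trans_lt ?_)
    rw [lt_div_iff₀ hK, dist_eq_norm] at hxy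
    linarith
  linarith [dist_triangle (R x) (R y) z]

theorem isCompact_closure_coe_preimage {F : Submodule 𝕜 E} (hF : IsClosed (F : Set E)) {A : Set E}
    (hA : RelCompact A) : IsCompact ((↑) ⁻¹' closure A : Set F) :=
  hF.isClosedEmbedding_subtypeVal.isCompact_preimage hA

/-- The Jacobs–de Leeuw–Glicksberg projection on the almost periodic part of a bounded commutative
operator semigroup. -/
theorem existsUnique_isAapProjection [CompleteSpace E] {S : Subsemigroup (E →L[𝕜] E)} {M : ℝ}
    (hne : (S : Set (E →L[𝕜] E)).Nonempty) (hcomm : ∀ A ∈ S, ∀ B ∈ S, A * B = B * A)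
    (hM : ∀ R ∈ S, ∀ x, ‖R x‖ ≤ M * ‖x‖) : ∃! P, IsAapProjection S P := by
  have hcl := isClosed_aap hM
  refine existsUnique_isJdLGProjection (M := M) ?_ ?_ ?_ ?_ fun x => ?_
  · obtain ⟨R, hR⟩ := hne
    obtain ⟨A, hA, -⟩ := exists_restrictTo_aap hR
    exact ⟨A, hA⟩
  · rintro A ⟨R, hR, hAR⟩ B ⟨Q, hQ, hBQ⟩
    exact ⟨R * Q, mul_mem hR hQ, fun y => by
      rw [mul_apply_eq_comp, hAR, hBQ, mul_apply_eq_comp]⟩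
  · rintro A ⟨R, hR, hAR⟩ B ⟨Q, hQ, hBQ⟩
    ext y
    rw [mul_apply_eq_comp, hAR, hBQ, mul_apply_eq_comp, hBQ, hAR]
    exact DFunLike.congr_fun (hcomm R hR Q hQ) (y : E)
  · rintro A ⟨R, hR, hAR⟩ y
    have := hM R hR y
    rwa [← hAR] at this
  · refine (isCompact_closure_coe_preimage hcl x.2).closure_of_subset ?_
    rintro _ ⟨A, ⟨R, hR, hAR⟩, rfl⟩
    exact subset_closure ⟨R, hR, (hAR x).symm⟩

/-- P is a strong limit of restrictions of commuting operators, so it commutes with them. -/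
theorem IsAapProjection.apply_comm {S : Subsemigroup (E →L[𝕜] E)} {P : aap S →L[𝕜] aap S}
    (hP : IsAapProjection S P) (hcomm : ∀ A ∈ S, ∀ B ∈ S, A * B = B * A) {R : E →L[𝕜] E}
    (hR : R ∈ S) {y z : aap S} (hz : (z : E) = R y) : (P z : E) = R (P y) := by
  obtain ⟨A, hA, hAR⟩ := exists_restrictTo_aap hR
  have hPA : P * A = A * P := by
    refine commute_of_mem_sotClosure ?_ hP.mem_sotClosure (subset_sotClosure _ hA)
    rintro A ⟨R, hR, hAR⟩ B ⟨Q, hQ, hBQ⟩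
    ext y
    rw [mul_apply_eq_comp, hAR, hBQ, mul_apply_eq_comp, hBQ, hAR]
    exact DFunLike.congr_fun (hcomm R hR Q hQ) (y : E)
  have hzA : z = A y := Subtype.ext (hz.trans (hAR y).symm)
  rw [hzA, ← hAR]
  exact congrArg Subtype.val (DFunLike.congr_fun hPA y)

/-- The operators of the semigroup are bounded below on the range of the projection. -/
theorem IsAapProjection.norm_le {S : Subsemigroup (E →L[𝕜] E)} {P : aap S →L[𝕜] aap S}
    (hP : IsAapProjection S P) (hcomm : ∀ A ∈ S, ∀ B ∈ S, A * B = B * A) {M : ℝ}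
    (hM : ∀ R ∈ S, ∀ x, ‖R x‖ ≤ M * ‖x‖) {R : E →L[𝕜] E} (hR : R ∈ S) (y : aap S) :
    ‖(P y : E)‖ ≤ M * ‖R (P y)‖ := by
  obtain ⟨A, hA, hAR⟩ := exists_restrictTo_aap hR
  have hmaps : ∀ y ∈ LinearMap.range (P : aap S →ₗ[𝕜] aap S),
      A y ∈ LinearMap.range (P : aap S →ₗ[𝕜] aap S) := by
    rintro _ ⟨z, rfl⟩
    exact ⟨A z, Subtype.ext ((hP.apply_comm hcomm hR (hAR z)).trans (hAR (P z)).symm)⟩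
  -- The group inverse is the restriction of some Q in the closure, and Q inherits the bound M;
  -- hence ‖P y‖ = ‖Q R P y‖ ≤ M ‖R P y‖.
  obtain ⟨B, ⟨Q, hQ, hBQ⟩, -, hBA⟩ := hP.group_on_range.exists_inv (A.restrict hmaps)
    ⟨A, subset_sotClosure _ hA, fun _ => rfl⟩
  have h1 : Q (A (P y)) = P y := by
    have h2 := congrArg Subtype.val (DFunLike.congr_fun hBA ⟨P y, y, rfl⟩)
    rw [mul_apply_eq_comp, hBQ] at h2
    exact h2
  have h3 := norm_apply_le_of_mem_sotClosure (M := M) (fun C hC z => by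
    obtain ⟨R, hR, hCR⟩ := hC
    have := hM R hR z
    rwa [← hCR] at this) hQ (A (P y))
  rw [h1] at h3
  rw [← hAR]
  exact h3

end Closed

/-! ### The equivalence -/

section Main

variable {𝕜 : Type*} [RCLike 𝕜] {E : Type*} [NormedAddCommGroup E] [NormedSpace 𝕜 E]

theorem relCompact_neg {A : Set E} (hA : RelCompact A) : RelCompact (-A) :=
  hA.neg.closure_of_subset (Set.neg_subset_neg.2 subset_closure)

theorem relCompact_stableDifferences [CompleteSpace E] {S : Subsemigroup (E →L[𝕜] E)} {M : ℝ}
    (hM : ∀ R ∈ S, ∀ x, ‖R x‖ ≤ M * ‖x‖) (P : aap S →L[𝕜] aap S) {x : E} (hx : x ∈ aap S) :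
    RelCompact (stableDifferences S P x) := by
  have hK := isCompact_closure_coe_preimage (isClosed_aap hM) (mem_aap.1 hx)
  have hcont : Continuous fun w : aap S =>
      (((⟨x, hx⟩ - w) - P (⟨x, hx⟩ - w) : aap S) : E) := by fun_prop
  refine (hK.image hcont).closure_of_subset ?_
  rintro _ ⟨R, hR, y, hy, rfl⟩
  refine ⟨⟨R x, apply_mem_aap hR hx⟩, subset_closure ⟨R, hR, rfl⟩, ?_⟩
  obtain rfl : y = ⟨x, hx⟩ - ⟨R x, apply_mem_aap hR hx⟩ := Subtype.ext hy
  rfl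

theorem relCompact_orbit_of_relCompact_stableDifferences [CompleteSpace E]
    (hc0 : ¬ ContainsCZero 𝕜 E) {m : ℕ} {T : Fin m → E →L[𝕜] E}
    (hcomm : ∀ i j, Commute (T i) (T j)) (hpb : ∀ j, IsPowerBounded (T j))
    {P : aap (generatedSemigroup T) →L[𝕜] aap (generatedSemigroup T)}
    (hP : IsAapProjection (generatedSemigroup T) P) {x : E}
    (hx : ∀ j, RelCompact (orbit (generatedSemigroup T) (x - T j x)))
    (hst : RelCompact (stableDifferences (generatedSemigroup T) P x)) :
    RelCompact (orbit (generatedSemigroup T) x) := by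
  obtain ⟨M, hM⟩ := exists_norm_le_of_isPowerBounded hcomm hpb
  set K := max M 1 with hKdef
  have hle : ∀ v : E, ‖v‖ ≤ K * ‖v‖ := fun v =>
    le_mul_of_one_le_left (norm_nonneg _) (le_max_right _ _)
  have hK : ∀ (g : Submonoid.closure (Set.range T)) (v : E), ‖(g : E →L[𝕜] E) v‖ ≤ K * ‖v‖ :=
    fun g v => (g : E →L[𝕜] E).le_of_opNorm_le ((hM g g.2).trans (le_max_left _ _)) v
  have hKS : ∀ R ∈ generatedSemigroup T, ∀ v, ‖R v‖ ≤ K * ‖v‖ := fun R hR =>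
    hK ⟨R, mem_submonoid_closure_of_mem hR⟩
  have hcommS : ∀ A ∈ generatedSemigroup T, ∀ B ∈ generatedSemigroup T, A * B = B * A := by
    have := isMulCommutative_closure_range hcomm
    exact fun A hA B hB => setLike_mul_comm (mem_submonoid_closure_of_mem hA)
      (mem_submonoid_closure_of_mem hB)
  have hcases : ∀ g : Submonoid.closure (Set.range T),
      (g : E →L[𝕜] E) = 1 ∨ (g : E →L[𝕜] E) ∈ generatedSemigroup T := fun g =>
    eq_one_or_mem_of_mem_submonoid_closure g.2
  have hmem : ∀ g : Submonoid.closure (Set.range T),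
      x - (g : E →L[𝕜] E) x ∈ aap (generatedSemigroup T) := fun g => by
    rcases hcases g with hg | hg
    · simp [hg]
    · exact sub_apply_mem_aap hx hg
  have hPg : ∀ (g : Submonoid.closure (Set.range T)) (y z : aap (generatedSemigroup T)),
      (z : E) = (g : E →L[𝕜] E) y → (P z : E) = (g : E →L[𝕜] E) (P y) := fun g y z hz => by
    rcases hcases g with hg | hg
    · rw [hg] at hz ⊢
      obtain rfl : z = y := Subtype.ext hz
      rfl
    · exact hP.apply_comm hcommS hg hz
  have hPlow : ∀ (g : Submonoid.closure (Set.range T)) (y : aap (generatedSemigroup T)),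
      ‖(P y : E)‖ ≤ K * ‖(g : E →L[𝕜] E) (P y)‖ := fun g y => by
    rcases hcases g with hg | hg
    · rw [hg]
      exact hle _
    · exact hP.norm_le hcommS hKS hg y
  -- The cocycle lives on the generated monoid because Dickson quotients may be the identity, where
  -- b vanishes.
  set b : Submonoid.closure (Set.range T) → E := fun g => P ⟨x - (g : E →L[𝕜] E) x, hmem g⟩
    with hb
  have hbT : TotallyBounded (Set.range b) := by
    refine totallyBounded_range_cocycle (𝕜 := 𝕜) hc0
      (ρ := fun g : Submonoid.closure (Set.range T) => (g : E →L[𝕜] E))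
      (K := K) (C := ‖P‖ * (‖x‖ + K * ‖x‖)) ?_ ?_ (fun _ _ _ => rfl) ?_ hK ?_ ?_
      (exists_strictMono_forall_eq_mul hcomm)
    · have : (⟨x - ((1 : Submonoid.closure (Set.range T)) : E →L[𝕜] E) x, hmem 1⟩ :
          aap (generatedSemigroup T)) = 0 := Subtype.ext (by simp)
      simp only [hb, this, map_zero, ZeroMemClass.coe_zero]
    · intro g h
      have hz : (g : E →L[𝕜] E) (x - (h : E →L[𝕜] E) x) ∈ aap (generatedSemigroup T) := by
        have := sub_mem (hmem (g * h)) (hmem g)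
        simpa using this
      have h1 : (⟨x - ((g * h : Submonoid.closure (Set.range T)) : E →L[𝕜] E) x, hmem (g * h)⟩ :
          aap (generatedSemigroup T)) = ⟨x - (g : E →L[𝕜] E) x, hmem g⟩ + ⟨_, hz⟩ :=
        Subtype.ext (by simp)
      simp only [hb, h1, map_add, Submodule.coe_add]
      rw [hPg g ⟨_, hmem h⟩ ⟨_, hz⟩ rfl]
    · intro g
      refine (P.le_opNorm ⟨x - (g : E →L[𝕜] E) x, hmem g⟩).trans ?_
      exact mul_le_mul_of_nonneg_left ((norm_sub_le _ _).trans (add_le_add_right (hK g x) _))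
        (norm_nonneg _)
    · intro g h w
      have hz : (h : E →L[𝕜] E) (x - (w : E →L[𝕜] E) x) ∈ aap (generatedSemigroup T) := by
        have := sub_mem (hmem (h * w)) (hmem h)
        simpa using this
      have h1 : (h : E →L[𝕜] E) (b w) - b w = P (⟨_, hz⟩ - ⟨_, hmem w⟩) := by
        rw [map_sub, Submodule.coe_sub, hPg h ⟨_, hmem w⟩ ⟨_, hz⟩ rfl]
      rw [h1]
      exact hPlow g _
    · intro w
      have hw : RelCompact (orbit (generatedSemigroup T) (b w)) :=
        (P ⟨x - (w : E →L[𝕜] E) x, hmem w⟩).2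
      refine (hw.union (isCompact_singleton (x := b w))).closure_of_subset ?_
      rintro _ ⟨g, rfl⟩
      rcases hcases g with hg | hg
      · right
        simp [hg]
      · exact Or.inl (subset_closure ⟨_, hg, rfl⟩)
  have hbc : RelCompact (Set.range b) := relCompact_iff_totallyBounded.2 hbT
  -- Decomposition R x = x - b(R) - ((x - R x) - b(R)).
  refine relCompact_add (relCompact_add (isCompact_singleton (x := x)).closure (relCompact_neg hbc)
    Set.Subset.rfl) (relCompact_neg hst) ?_
  rintro _ ⟨R, hR, rfl⟩
  set g : Submonoid.closure (Set.range T) := ⟨R, mem_submonoid_closure_of_mem hR⟩ with hg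
  refine ⟨x + -b g, ⟨x, rfl, -b g, Set.neg_mem_neg.2 ⟨g, rfl⟩, rfl⟩,
    -((x - R x) - b g), Set.neg_mem_neg.2 ⟨R, hR, ⟨x - R x, hmem g⟩, rfl, rfl⟩, ?_⟩
  change x + -b g + -((x - R x) - b g) = R x
  abel

end Main

end OrbitCompactness

theorem proposition3p9 {𝕜 : Type*} [RCLike 𝕜] {E : Type*} [NormedAddCommGroup E]
    [NormedSpace 𝕜 E] [CompleteSpace E] (hc0 : ¬ OrbitCompactness.ContainsCZero 𝕜 E)
    {m : ℕ} (hm : 0 < m) (T : Fin m → E →L[𝕜] E)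
    (hcomm : ∀ i j, Commute (T i) (T j))
    (hpb : ∀ j, OrbitCompactness.IsPowerBounded (T j)) :
    (∃! P, OrbitCompactness.IsAapProjection (OrbitCompactness.generatedSemigroup T) P) ∧
    ∀ P, OrbitCompactness.IsAapProjection (OrbitCompactness.generatedSemigroup T) P →
      ∀ x : E,
        OrbitCompactness.RelCompact
            (OrbitCompactness.orbit (OrbitCompactness.generatedSemigroup T) x) ↔
          (∀ j, OrbitCompactness.RelCompact
            (OrbitCompactness.orbit (OrbitCompactness.generatedSemigroup T) (x - T j x))) ∧
          OrbitCompactness.RelCompact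
            (OrbitCompactness.stableDifferences (OrbitCompactness.generatedSemigroup T) P x) := by
  obtain ⟨M, hM⟩ := OrbitCompactness.exists_norm_le_of_isPowerBounded hcomm hpb
  have hMS : ∀ R ∈ OrbitCompactness.generatedSemigroup T, ∀ v, ‖R v‖ ≤ M * ‖v‖ := fun R hR v =>
    R.le_of_opNorm_le (hM R (OrbitCompactness.mem_submonoid_closure_of_mem hR)) v
  have hT : ∀ j, T j ∈ OrbitCompactness.generatedSemigroup T := fun j =>
    Subsemigroup.subset_closure ⟨j, rfl⟩
  refine ⟨OrbitCompactness.existsUnique_isAapProjection ⟨T ⟨0, hm⟩, hT _⟩ ?_ hMS,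
    fun P hP x => ⟨fun hx => ⟨fun j => ?_, ?_⟩, fun h => ?_⟩⟩
  · have := OrbitCompactness.isMulCommutative_closure_range hcomm
    exact fun A hA B hB => setLike_mul_comm (OrbitCompactness.mem_submonoid_closure_of_mem hA)
      (OrbitCompactness.mem_submonoid_closure_of_mem hB)
  · exact sub_mem (OrbitCompactness.mem_aap.2 hx) (OrbitCompactness.apply_mem_aap (hT j) hx)
  · exact OrbitCompactness.relCompact_stableDifferences hMS P hx
  · exact OrbitCompactness.relCompact_orbit_of_relCompact_stableDifferences hc0 hcomm hpb hP h.1 h.2
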